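/- Let $\mathcal{K}^n_0$ be the set of centrally symmetric convex bodies in $\mathbb{R}^n$, i.e. compact convex sets $K\subset\mathbb{R}^n$ with nonempty interior and $K=-K$. For $A\subseteq\mathbb{R}^n$ let $\dim A$ be the dimension of its affine hull, let $\#(K\cap\mathbb{Z}^n)$ be the number of lattice points in $K$, and $\mathrm{vol}$ the Lebesgue measure. (For $K\in\mathcal{K}^n_0$, the condition $\dim(K\cap\mathbb{Z}^n)=n$ means that $K$ contains $n$ linearly independent lattice points.) (i) For every $\varepsilon\in(0,1]$ there is an $n(\varepsilon)\in\mathbb{N}$ such that for every $n\ge n(\varepsilon)$ and every $K\in\mathcal{K}^n_0$ with $\dim(K\cap\mathbb{Z}^n)=n$, $$\mathrm{vol}(K)\ \ge\ \frac{(2-\varepsilon)^n}{n!}\,\#(K\cap\mathbb{Z}^n).$$ (ii) For every $n\in\mathbb{N}$ and every $K\in\mathcal{K}^n_0$ with $\dim(K\cap\mathbb{Z}^n)=n$, $$\#(K\cap\mathbb{Z}^n)\ \le\ \mathrm{vol}(K)\,\frac{n!\,L_n(2)}{2^n},\qquad\text{where } L_n(x)=\sum_{k=0}^n\binom nk\frac{x^k}{k!}.$$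 (iii) The constant $2$ in (i) cannot be replaced by a bigger one: for every real $c>2$, statement (i) with $(c-\varepsilon)^n$ in place of $(2-\varepsilon)^n$ is false. This is shown by the crosspolytopes $C_{n,l}=\mathrm{conv}\{\pm l e_1,\pm e_2,\dots,\pm e_n\}$: for all integers $n,l\ge1$ one has $C_{n,l}\in\mathcal{K}^n_0$ and $\dim(C_{n,l}\cap\mathbb{Z}^n)=n$, and $$\sqrt[n]{\frac{n!\,\mathrm{vol}(C_{n,l})}{\#(C_{n,l}\cap\mathbb{Z}^n)}}\ \longrightarrow\ 2\qquad\text{as } n,l\to\infty .$$ -/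

import Mathlib

open MeasureTheory Filter Topology

/-- Convex bodies of `ℝⁿ`: compact convex sets with nonempty interior. (No norm enters, so `ℝⁿ` is
taken to be `Fin n → ℝ`, with its usual topology and Lebesgue measure `volume`.) -/
structure IsBody {n : ℕ} (K : Set (Fin n → ℝ)) : Prop where
  convex : Convex ℝ K
  isCompact : IsCompact K
  nonempty_interior : (interior K).Nonempty

/-- Centrally symmetric convex bodies: convex bodies with `K = -K`. -/
structure IsSymmBody {n : ℕ} (K : Set (Fin n → ℝ)) : Prop extends IsBody K where
  symm : ∀ x, x ∈ K ↔ -x ∈ K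

/-- The integer lattice `ℤⁿ` as a subset of `ℝⁿ`. -/
def intLattice (n : ℕ) : Set (Fin n → ℝ) :=
  {x | ∀ i, ∃ z : ℤ, x i = z}

/-- The lattice point enumerator `#(S ∩ ℤⁿ)`, for bounded sets `S`
(the intersection is then finite). -/
noncomputable def latticeCount {n : ℕ} (S : Set (Fin n → ℝ)) : ℕ :=
  (S ∩ intLattice n).ncard

/-- The dimension of a (nonempty) set: the dimension of its affine hull. -/
noncomputable def affDim {n : ℕ} (A : Set (Fin n → ℝ)) : ℕ :=
  Module.finrank ℝ (affineSpan ℝ A).direction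

/-- The polynomial `L_n(x) = ∑_{k=0}^n (n choose k) x^k / k!`. -/
noncomputable def laguerre (n : ℕ) (x : ℝ) : ℝ :=
  ∑ k ∈ Finset.range (n + 1), (n.choose k : ℝ) * x ^ k / (k.factorial : ℝ)

/-- The crosspolytope `conv {± l e₁, ± e₂, …, ± eₙ}`; the coordinate of index `0 : Fin n` plays
the role of the first one. -/
def crosspolytope (n l : ℕ) : Set (Fin n → ℝ) :=
  convexHull ℝ {v | ∃ i : Fin n, v = Pi.single i (if (i : ℕ) = 0 then (l : ℝ) else 1) ∨
    v = -Pi.single i (if (i : ℕ) = 0 then (l : ℝ) else 1)}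

/-! The count compares lattice points with volumes of unit cubes. Full dimension gives a nonsingular
integer matrix `W` whose columns, and by symmetry their negatives, lie in `K`. The lattice points of
`K` are split into the `|det W|` classes modulo `Wℤⁿ`. After applying `W⁻¹`, the points of one class
differ by integer vectors and lie in a convex body `W⁻¹K` containing the standard crosspolytope.
Unit cubes at these points are disjoint, so their number is at most `vol(W⁻¹K + [0,1]ⁿ)`. Since
`vol(W⁻¹K) = vol(K) / |det W|`, summing over the classes cancels the determinant.

It remains to bound `vol(K + [0,1]ⁿ)` by a multiple of `vol(K)` when `K` contains the crosspolytope
(`volume_real_add_frontCube_le`). The cube is added one edge at a time. Each edge adds at most the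
volume of a projection (`volume_add_segment_le`), and projecting `K` itself costs a factor of half
the dimension, because `K` contains `± eᵢ` (`volume_removeNth_image_le`). The resulting recursion
has the solution `cubeFactor`, which on the diagonal is `n! L_n(2) / 2ⁿ`.

This is (ii). Subexponential growth of `L_n(2)` then gives (i), and an explicit volume and lattice
point count for crosspolytopes gives (iii). -/

/-! ### Slices, and the sum of a body with a segment. -/

open Pointwise in
theorem volume_add_Icc_le {F : Set ℝ} (hF : Convex ℝ F) (hc : IsCompact F) (hne : F.Nonempty) :
    volume (F + Set.Icc (0 : ℝ) 1) ≤ volume F + 1 := by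
  have hconn : IsConnected F := ⟨hne, hF.isPreconnected⟩
  obtain ⟨a, b, hab⟩ : ∃ a b : ℝ, F = Set.Icc a b :=
    ⟨_, _, eq_Icc_of_connected_compact hconn hc⟩
  subst hab
  have hle : a ≤ b := Set.nonempty_Icc.1 hne
  calc volume (Set.Icc a b + Set.Icc (0 : ℝ) 1) ≤ volume (Set.Icc a (b + 1)) := by
        apply measure_mono
        rintro _ ⟨x, hx, y, hy, rfl⟩
        exact ⟨by simp only []; linarith [hx.1, hy.1], by simp only []; linarith [hx.2, hy.2]⟩
    _ = volume (Set.Icc a b) + 1 := by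
        rw [Real.volume_Icc, Real.volume_Icc, ← ENNReal.ofReal_one,
          ← ENNReal.ofReal_add (by linarith) zero_le_one]
        congr 1; ring

/-- The slice of `A` over `y`, in the direction of the coordinate `i`. -/
def fiberAt {n : ℕ} (i : Fin (n + 1)) (A : Set (Fin (n + 1) → ℝ)) (y : Fin n → ℝ) : Set ℝ :=
  {t | i.insertNth (α := fun _ => ℝ) t y ∈ A}

theorem continuous_insertNth {n : ℕ} (i : Fin (n + 1)) :
    Continuous fun q : ℝ × (Fin n → ℝ) => i.insertNth (α := fun _ => ℝ) q.1 q.2 := by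
  refine continuous_pi fun j => ?_
  rcases Fin.eq_self_or_eq_succAbove i j with rfl | ⟨k, rfl⟩
  · simpa using continuous_fst
  · simpa using (by fun_prop : Continuous fun q : ℝ × (Fin n → ℝ) => q.2 k)

theorem continuous_removeNth {n : ℕ} (i : Fin (n + 1)) :
    Continuous fun x : Fin (n + 1) → ℝ => (i.removeNth x : Fin n → ℝ) :=
  continuous_pi fun _ => continuous_apply _

theorem volume_eq_lintegral_fiberAt {n : ℕ} (i : Fin (n + 1)) {A : Set (Fin (n + 1) → ℝ)}
    (hA : MeasurableSet A) : volume A = ∫⁻ y, volume (fiberAt i A y) := by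
  have h := (volume_preserving_piFinSuccAbove (fun _ : Fin (n + 1) => ℝ) i).symm
  rw [← h.measure_preimage_equiv, Measure.volume_eq_prod, Measure.prod_apply_symm
    ((MeasurableEquiv.measurable _) hA)]
  rfl

theorem measurable_volume_fiberAt {n : ℕ} (i : Fin (n + 1)) {A : Set (Fin (n + 1) → ℝ)}
    (hA : MeasurableSet A) : Measurable fun y => volume (fiberAt i A y) :=
  measurable_measure_prodMk_right ((continuous_insertNth i).measurable hA)

theorem convex_fiberAt {n : ℕ} (i : Fin (n + 1)) {A : Set (Fin (n + 1) → ℝ)}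
    (hA : Convex ℝ A) (y : Fin n → ℝ) : Convex ℝ (fiberAt i A y) := by
  intro s hs t ht a b ha hb hab
  have := hA hs ht ha hb hab
  simp only [fiberAt, Set.mem_ofPred_eq]
  convert this using 1
  refine (Fin.insertNth_eq_iff).2 ⟨by simp, ?_⟩
  funext j
  simp [Fin.removeNth, ← add_mul, hab]

theorem isCompact_fiberAt {n : ℕ} (i : Fin (n + 1)) {A : Set (Fin (n + 1) → ℝ)}
    (hA : IsCompact A) (y : Fin n → ℝ) : IsCompact (fiberAt i A y) := by
  refine (hA.image (continuous_apply i)).of_isClosed_subset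
    (hA.isClosed.preimage ((continuous_insertNth i).comp (by fun_prop : Continuous fun t : ℝ => (t, y))))
    fun t ht => ⟨_, ht, by simp⟩

theorem fiberAt_nonempty_iff {n : ℕ} (i : Fin (n + 1)) {A : Set (Fin (n + 1) → ℝ)}
    {y : Fin n → ℝ} : (fiberAt i A y).Nonempty ↔ y ∈ (fun x => i.removeNth x) '' A := by
  constructor
  · rintro ⟨t, ht⟩
    exact ⟨_, ht, by simp⟩
  · rintro ⟨x, hx, rfl⟩
    exact ⟨x i, by simpa [fiberAt] using hx⟩

open Pointwise in
/-- Adding a unit segment in a coordinate direction to a convex body increases the volume by at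
most the volume of the projection along that direction. -/
theorem volume_add_segment_le {n : ℕ} (i : Fin (n + 1)) {A : Set (Fin (n + 1) → ℝ)}
    (hc : IsCompact A) (hA : Convex ℝ A) :
    volume (A + (fun t : ℝ => (Pi.single i t : Fin (n + 1) → ℝ)) '' Set.Icc 0 1) ≤
      volume A + volume ((fun x => (i.removeNth x : Fin n → ℝ)) '' A) := by
  have hcS : IsCompact ((fun t : ℝ => (Pi.single i t : Fin (n + 1) → ℝ)) '' Set.Icc 0 1) :=
    isCompact_Icc.image (continuous_single (A := fun _ => ℝ) i)
  have hP := (hc.image (continuous_removeNth i)).isClosed.measurableSet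
  rw [volume_eq_lintegral_fiberAt i (hc.add hcS).isClosed.measurableSet,
    volume_eq_lintegral_fiberAt i hc.isClosed.measurableSet, ← lintegral_indicator_one hP,
    ← lintegral_add_left (measurable_volume_fiberAt i hc.isClosed.measurableSet)]
  refine lintegral_mono fun y => ?_
  -- The segment is parallel to the slices, so each nonempty slice grows in length by at most 1 and
  -- empty slices stay empty.
  have hsub : fiberAt i (A + (fun t : ℝ => (Pi.single i t : Fin (n + 1) → ℝ)) '' Set.Icc 0 1) y ⊆
      fiberAt i A y + Set.Icc (0 : ℝ) 1 := by
    rintro t ⟨a, ha, _, ⟨s, hs, rfl⟩, hat⟩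
    refine ⟨t - s, ?_, s, hs, by simp⟩
    have : a = i.insertNth (α := fun _ => ℝ) (t - s) y := by
      rw [eq_comm, Fin.insertNth_eq_iff]
      constructor
      · have := congrFun hat i
        simp at this ⊢
        linarith
      · funext j
        have := congrFun hat (i.succAbove j)
        simpa [Fin.removeNth, Fin.succAbove_ne] using this.symm
    simpa [fiberAt, ← this] using ha
  by_cases hy : y ∈ (fun x => (i.removeNth x : Fin n → ℝ)) '' A
  · simp only [Set.indicator_of_mem hy, Pi.one_apply]
    exact (measure_mono hsub).trans (volume_add_Icc_le (convex_fiberAt i hA y)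
      (isCompact_fiberAt i hc y) ((fiberAt_nonempty_iff i).2 hy))
  · have : fiberAt i A y = ∅ := by
      rw [← Set.not_nonempty_iff_eq_empty, fiberAt_nonempty_iff]; exact hy
    rw [this, Set.empty_add, Set.subset_empty_iff] at hsub
    simp [hsub]

/-! ### Volume of a projection along a segment contained in the body. -/

/-- The volume of the cone with apex at the origin and base `{1} × P`. -/
theorem volume_cone {n : ℕ} (P : Set (Fin n → ℝ))
    (hT : MeasurableSet {q : ℝ × (Fin n → ℝ) | q.1 ∈ Set.Icc (0 : ℝ) 1 ∧ ∃ p ∈ P, q.2 = q.1 • p}) :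
    (n + 1 : ℝ).toNNReal *
      volume {q : ℝ × (Fin n → ℝ) | q.1 ∈ Set.Icc (0 : ℝ) 1 ∧ ∃ p ∈ P, q.2 = q.1 • p} =
    volume P := by
  rw [Measure.volume_eq_prod, Measure.prod_apply hT]
  -- The slice at height `s` is `s • P`; integrating `s ^ n` over `[0, 1]` gives `1 / (n + 1)`.
  have h : ∀ s : ℝ, volume (Prod.mk s ⁻¹'
      {q : ℝ × (Fin n → ℝ) | q.1 ∈ Set.Icc (0 : ℝ) 1 ∧ ∃ p ∈ P, q.2 = q.1 • p}) =
      (Set.Icc (0 : ℝ) 1).indicator (fun s => ENNReal.ofReal (s ^ n) * volume P) s := by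
    intro s
    by_cases hs : s ∈ Set.Icc (0 : ℝ) 1
    · rw [Set.indicator_of_mem hs]
      have := Measure.addHaar_smul (volume : Measure (Fin n → ℝ)) s P
      rw [Module.finrank_fin_fun, abs_of_nonneg (pow_nonneg hs.1 n)] at this
      rw [← this]
      congr 1
      ext y
      simp only [Set.mem_preimage, Set.mem_ofPred_eq, hs, true_and, Set.mem_smul_set]
      exact exists_congr fun p => and_congr_right fun _ => eq_comm
    · rw [Set.indicator_of_notMem hs]
      convert measure_empty (μ := (volume : Measure (Fin n → ℝ)))
      ext y
      simp only [Set.mem_preimage, Set.mem_ofPred_eq, hs, false_and, Set.mem_empty_iff_false]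
  simp_rw [h]
  rw [lintegral_indicator measurableSet_Icc, lintegral_mul_const _ (by fun_prop), ← mul_assoc]
  have hI : ∫⁻ s in Set.Icc (0 : ℝ) 1, ENNReal.ofReal (s ^ n) = ENNReal.ofReal (1 / (n + 1)) := by
    rw [← ofReal_integral_eq_lintegral_ofReal]
    · rw [integral_Icc_eq_integral_Ioc, ← intervalIntegral.integral_of_le zero_le_one, integral_pow]
      simp
    · exact (continuous_pow n).continuousOn.integrableOn_Icc
    · filter_upwards [ae_restrict_mem measurableSet_Icc] with s hs using pow_nonneg hs.1 n
  rw [hI, ← ENNReal.ofReal, ← ENNReal.ofReal_mul (by positivity)]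
  rw [mul_one_div_cancel (by positivity)]
  simp

/-- A convex body that contains a symmetric unit segment in a coordinate direction has volume at
least `2 / (n + 1)` times that of its projection along this direction. -/
theorem volume_removeNth_image_le {n : ℕ} (i : Fin (n + 1)) {A : Set (Fin (n + 1) → ℝ)}
    (hc : IsCompact A) (hA : Convex ℝ A) (h₁ : Pi.single i 1 ∈ A) (h₂ : -Pi.single i 1 ∈ A) :
    2 * volume ((fun x => (i.removeNth x : Fin n → ℝ)) '' A) ≤
      (n + 1 : ℝ).toNNReal * volume A := by
  set P := (fun x => (i.removeNth x : Fin n → ℝ)) '' A with hP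
  have hPc : IsCompact P := hc.image (continuous_removeNth i)
  set T := {q : ℝ × (Fin n → ℝ) | q.1 ∈ Set.Icc (0 : ℝ) 1 ∧ ∃ p ∈ P, q.2 = q.1 • p} with hTdef
  have hT : MeasurableSet T := by
    have : T = (fun q : ℝ × (Fin n → ℝ) => (q.1, q.1 • q.2)) '' (Set.Icc (0 : ℝ) 1 ×ˢ P) := by
      ext ⟨s, y⟩
      simp only [hTdef, Set.mem_ofPred_eq, Set.mem_image, Set.mem_prod, Prod.exists, Prod.mk.injEq]
      constructor
      · rintro ⟨hs, p, hp, rfl⟩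
        exact ⟨s, p, ⟨hs, hp⟩, rfl, rfl⟩
      · rintro ⟨s, p, ⟨hs, hp⟩, rfl, rfl⟩
        exact ⟨hs, p, hp, rfl⟩
    rw [this]
    exact ((isCompact_Icc.prod hPc).image (by fun_prop)).isClosed.measurableSet
  -- Compared slice by slice over `y`: if `y = s • p` and `x ∈ A` projects to `p`, then `s • x ± (1
  -- - s) • eᵢ` lie in `A`, so the slice of `A` has length at least `2 * (1 - s)`. The slice of `T`
  -- lies between the least such `s` and 1.
  have key : 2 * volume T ≤ volume A := by
    rw [Measure.volume_eq_prod, Measure.prod_apply_symm hT,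
      volume_eq_lintegral_fiberAt i hc.isClosed.measurableSet,
      ← lintegral_const_mul _ (measurable_measure_prodMk_right hT)]
    refine lintegral_mono fun y => ?_
    set F := (fun s : ℝ => (s, y)) ⁻¹' T with hF
    rcases F.eq_empty_or_nonempty with h0 | hne
    · simp [h0]
    have hbdd : BddBelow F := ⟨0, fun s hs => hs.1.1⟩
    have h1 : volume F ≤ ENNReal.ofReal (1 - sInf F) := by
      rw [← Real.volume_Icc]
      exact measure_mono fun s hs => ⟨csInf_le hbdd hs, hs.1.2⟩
    have h2 : ∀ s ∈ F, ENNReal.ofReal (2 * (1 - s)) ≤ volume (fiberAt i A y) := by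
      rintro s ⟨hs, p, ⟨x, hx, rfl⟩, hy⟩
      simp only at hs hy
      have : Set.Icc (s * x i - (1 - s)) (s * x i + (1 - s)) ⊆ fiberAt i A y := by
        rw [← segment_eq_Icc (by linarith [hs.2])]
        refine (convex_fiberAt i hA y).segment_subset ?_ ?_
        · have := hA hx h₂ hs.1 (sub_nonneg.2 hs.2) (by ring)
          simp only [fiberAt, Set.mem_ofPred_eq]
          convert this using 1
          refine (Fin.insertNth_eq_iff).2 ⟨by simp; ring, ?_⟩
          funext j
          simp [hy, Fin.removeNth, Fin.succAbove_ne]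
        · have := hA hx h₁ hs.1 (sub_nonneg.2 hs.2) (by ring)
          simp only [fiberAt, Set.mem_ofPred_eq]
          convert this using 1
          refine (Fin.insertNth_eq_iff).2 ⟨by simp, ?_⟩
          funext j
          simp [hy, Fin.removeNth, Fin.succAbove_ne]
      refine le_trans (le_of_eq ?_) (measure_mono this)
      rw [Real.volume_Icc]; congr 1; ring
    have h3 : ENNReal.ofReal (2 * (1 - sInf F)) ≤ volume (fiberAt i A y) := by
      obtain ⟨u, -, hu, huF⟩ := exists_seq_tendsto_sInf hne hbdd
      refine le_of_tendsto (ENNReal.tendsto_ofReal ((hu.const_sub 1).const_mul 2))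
        (Eventually.of_forall fun k => h2 _ (huF k))
    refine le_trans (mul_le_mul_right h1 2) (le_trans (le_of_eq ?_) h3)
    rw [ENNReal.ofReal_mul zero_le_two]; simp
  rw [← volume_cone P hT, ← mul_assoc, mul_comm 2, mul_assoc]
  exact mul_le_mul_right key _

/-! ### Adding a unit cube edge by edge. -/

/-- The unit cube in the first `m` coordinates. -/
def frontCube (n m : ℕ) : Set (Fin n → ℝ) :=
  Set.Icc 0 fun j => if (j : ℕ) < m then 1 else 0

/-- The constant in the comparison of the volumes of `K + frontCube n m` and of `K`. -/
noncomputable def cubeFactor (n m : ℕ) : ℝ :=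
  ∑ k ∈ Finset.range (m + 1), (m.choose k : ℝ) * n.descFactorial k / 2 ^ k

/-- Pascal's rule together with the recursion of the falling factorial. The second term accounts for
the projection met when the next edge is added. -/
theorem cubeFactor_succ (n m : ℕ) :
    cubeFactor (n + 1) (m + 1) = cubeFactor (n + 1) m + (n + 1) / 2 * cubeFactor n m := by
  unfold cubeFactor
  rw [Finset.sum_range_succ' _ (m + 1), Finset.mul_sum]
  have h : ∑ k ∈ Finset.range (m + 1), (m.choose k : ℝ) * (n + 1).descFactorial k / 2 ^ k =
      ∑ k ∈ Finset.range (m + 1), (m.choose (k + 1) : ℝ) * (n + 1).descFactorial (k + 1) / 2 ^ (k + 1)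
        + 1 := by
    rw [Finset.sum_range_succ', Finset.sum_range_succ _ m]
    simp
  rw [h, add_right_comm, ← Finset.sum_add_distrib]
  congr 1
  · refine Finset.sum_congr rfl fun k _ => ?_
    rw [Nat.choose_succ_succ, Nat.succ_descFactorial_succ]
    push_cast
    ring
  · simp

/-- Reverse the summation by `k ↦ n - k` and use that the falling factorial of length `n - k` is `n!
/ k!`. -/
theorem cubeFactor_self (n : ℕ) :
    cubeFactor n n = (n.factorial : ℝ) * laguerre n 2 / 2 ^ n := by
  unfold cubeFactor laguerre
  rw [← Finset.sum_range_reflect, Finset.mul_sum, Finset.sum_div]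
  refine Finset.sum_congr rfl fun k hk => ?_
  have hk : k ≤ n := Nat.lt_succ_iff.1 (Finset.mem_range.1 hk)
  rw [Nat.add_sub_cancel, Nat.choose_symm hk]
  have h1 := Nat.factorial_mul_descFactorial (Nat.sub_le n k)
  rw [Nat.sub_sub_self hk] at h1
  rw [← h1]
  have h2 : (2 : ℝ) ^ n = 2 ^ (n - k) * 2 ^ k := by rw [← pow_add, Nat.sub_add_cancel hk]
  rw [h2]
  have := Nat.factorial_pos k
  push_cast
  field_simp

theorem isCompact_frontCube (n m : ℕ) : IsCompact (frontCube n m) := isCompact_Icc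

theorem convex_frontCube (n m : ℕ) : Convex ℝ (frontCube n m) := convex_Icc _ _

open Pointwise in
theorem frontCube_succ {n m : ℕ} (hm : m < n) :
    frontCube n (m + 1) ⊆
      frontCube n m + (fun t : ℝ => (Pi.single ⟨m, hm⟩ t : Fin n → ℝ)) '' Set.Icc 0 1 := by
  intro x hx
  refine ⟨fun j => if (j : ℕ) < m then x j else 0, ⟨fun j => ?_, fun j => ?_⟩,
    _, ⟨x ⟨m, hm⟩, ⟨hx.1 _, by simpa using hx.2 ⟨m, hm⟩⟩, rfl⟩, ?_⟩
  · by_cases h : (j : ℕ) < m <;> simp [h]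
    exact hx.1 j
  · by_cases h : (j : ℕ) < m <;> simp [h]
    simpa [h.trans (Nat.lt_succ_self m)] using hx.2 j
  · funext j
    rcases lt_trichotomy (j : ℕ) m with h | h | h
    · have : j ≠ ⟨m, hm⟩ := fun e => by simp [e] at h
      simp [h, this]
    · have : j = ⟨m, hm⟩ := Fin.ext h
      subst this
      simp
    · have h1 : j ≠ ⟨m, hm⟩ := fun e => by simp [e] at h
      have h2 := hx.2 j
      have h3 : (0 : ℝ) ≤ x j := hx.1 j
      simp only [if_neg (by omega : ¬ (j : ℕ) < m + 1)] at h2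
      simp only [h.not_gt, if_false, Pi.add_apply, Pi.single_eq_of_ne h1]
      linarith

/-- The deleted coordinate `m` is the first one in which the cube is flat, so all `m` edges survive.
-/
theorem removeNth_mem_frontCube {n m : ℕ} (hm : m < n + 1) {x : Fin (n + 1) → ℝ}
    (hx : x ∈ frontCube (n + 1) m) :
    (Fin.removeNth ⟨m, hm⟩ x : Fin n → ℝ) ∈ frontCube n m := by
  refine ⟨fun j => hx.1 _, fun j => ?_⟩
  have h := hx.2 (Fin.succAbove ⟨m, hm⟩ j)
  simp only [Fin.removeNth]
  refine h.trans (le_of_eq ?_)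
  refine if_congr ?_ rfl rfl
  by_cases hj : (j : ℕ) < m
  · rw [Fin.succAbove_of_castSucc_lt _ _ (by simpa [Fin.lt_def] using hj)]
    simp
  · rw [Fin.succAbove_of_le_castSucc _ _ (by simpa [Fin.le_def] using hj)]
    simp; omega

open Pointwise in
/-- The volume of the sum of a convex body containing the standard crosspolytope with a unit
cube. -/
theorem volume_real_add_frontCube_le (m : ℕ) : ∀ {n : ℕ}, m ≤ n → ∀ {K : Set (Fin n → ℝ)},
    IsCompact K → Convex ℝ K → (∀ i, Pi.single i 1 ∈ K) → (∀ i, -Pi.single i 1 ∈ K) →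
      volume.real (K + frontCube n m) ≤ cubeFactor n m * volume.real K := by
  -- The dimension stays universally quantified: the step applies the hypothesis both to `K` and to
  -- its projection, one dimension lower.
  induction m with
  | zero =>
    intro n _ K _ _ _ _
    have : frontCube n 0 = 0 := by
      simp only [frontCube, Nat.not_lt_zero, if_false]
      exact Set.Icc_self (0 : Fin n → ℝ)
    simp [this, cubeFactor]
  | succ m ih =>
    intro n hmn K hc hK h₁ h₂
    obtain ⟨n, rfl⟩ : ∃ k, n = k + 1 := ⟨n - 1, by omega⟩
    set i : Fin (n + 1) := ⟨m, hmn⟩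
    set π : (Fin (n + 1) → ℝ) → (Fin n → ℝ) := fun x => i.removeNth x with hπ
    have hPc : IsCompact (π '' K) := hc.image (continuous_removeNth i)
    have hπl : IsLinearMap ℝ π := ⟨fun _ _ => rfl, fun _ _ => rfl⟩
    have hPK : Convex ℝ (π '' K) := hK.is_linear_image hπl
    have hsingle : ∀ j : Fin n, π (Pi.single (i.succAbove j) 1) = Pi.single j 1 := by
      intro j
      funext k
      simp [hπ, Fin.removeNth, Pi.single_apply]
    have ih1 := ih (by omega : m ≤ n + 1) hc hK h₁ h₂
    have ih2 := ih (by omega : m ≤ n) hPc hPK (fun j => ⟨_, h₁ _, hsingle j⟩)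
      (fun j => ⟨_, h₂ (i.succAbove j), by rw [← hsingle]; rfl⟩)
    have hcA : IsCompact (K + frontCube (n + 1) m) := hc.add (isCompact_frontCube _ _)
    have hstep := volume_add_segment_le i hcA (hK.add (convex_frontCube _ _))
    have hfin : ∀ {d : ℕ} {S : Set (Fin d → ℝ)}, IsCompact S → volume S ≠ ⊤ :=
      fun h => h.measure_ne_top
    have hproj := volume_removeNth_image_le i hc hK (h₁ i) (h₂ i)
    have hproj' : volume.real (π '' K) ≤ (n + 1) / 2 * volume.real K := by
      have := ENNReal.toReal_mono (ENNReal.mul_ne_top ENNReal.coe_ne_top (hfin hc)) hproj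
      rw [ENNReal.toReal_mul, ENNReal.toReal_mul, ENNReal.coe_toReal,
        Real.coe_toNNReal _ (by positivity)] at this
      simp only [ENNReal.toReal_ofNat] at this
      simp only [Measure.real]
      linarith
    have hsub : π '' (K + frontCube (n + 1) m) ⊆ π '' K + frontCube n m := by
      rintro _ ⟨_, ⟨x, hx, b, hb, rfl⟩, rfl⟩
      exact ⟨π x, ⟨x, hx, rfl⟩, π b, removeNth_mem_frontCube hmn hb, rfl⟩
    have hc2 : IsCompact (π '' K + frontCube n m) := hPc.add (isCompact_frontCube _ _)
    have h3 : volume.real (K + frontCube (n + 1) (m + 1)) ≤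
        volume.real (K + frontCube (n + 1) m) + volume.real (π '' K + frontCube n m) := by
      have : volume (K + frontCube (n + 1) (m + 1)) ≤
          volume (K + frontCube (n + 1) m) + volume (π '' K + frontCube n m) := by
        refine le_trans (measure_mono ?_) (hstep.trans (add_le_add le_rfl (measure_mono hsub)))
        rw [add_assoc]
        exact Set.add_subset_add_left (frontCube_succ hmn)
      have := ENNReal.toReal_mono (ENNReal.add_ne_top.2 ⟨hfin hcA, hfin hc2⟩) this
      rwa [ENNReal.toReal_add (hfin hcA) (hfin hc2)] at this
    have hpos : 0 ≤ cubeFactor n m := Finset.sum_nonneg fun k _ => by positivity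
    rw [cubeFactor_succ]
    calc _ ≤ _ := h3
      _ ≤ cubeFactor (n + 1) m * volume.real K +
          cubeFactor n m * ((n + 1) / 2 * volume.real K) :=
        add_le_add ih1 (ih2.trans (mul_le_mul_of_nonneg_left hproj' hpos))
      _ = _ := by ring

/-! ### Counting lattice points by residue classes. -/

open Pointwise in
/-- Points of `K` that are congruent modulo `ℤⁿ` are at most as many as the volume of
`K + [0, 1]ⁿ`. -/
theorem card_le_volume_real_add_frontCube {n : ℕ} {α : Type*} (s : Finset α)
    (p : α → Fin n → ℝ) {K : Set (Fin n → ℝ)} (hK : IsCompact K) (hp : ∀ a ∈ s, p a ∈ K)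
    (hinj : Set.InjOn p s) (hint : ∀ a ∈ s, ∀ b ∈ s, p a - p b ∈ intLattice n) :
    (s.card : ℝ) ≤ volume.real (K + frontCube n n) := by
  set Q : α → Set (Fin n → ℝ) := fun a => Set.univ.pi fun j => Set.Ico (p a j) (p a j + 1)
  have hQm : ∀ a ∈ s, MeasurableSet (Q a) := fun a _ => MeasurableSet.univ_pi fun _ => measurableSet_Ico
  -- Corners of two overlapping half-open unit cubes differ by less than 1 in each coordinate;
  -- integer differences must then vanish.
  have hdisj : Set.PairwiseDisjoint (s : Set α) Q := by
    intro a ha b hb hab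
    refine Set.disjoint_left.2 fun x hxa hxb => hab (hinj ha hb (funext fun j => ?_))
    obtain ⟨z, hz⟩ := hint a ha b hb j
    have h1 := hxa j (Set.mem_univ _)
    have h2 := hxb j (Set.mem_univ _)
    simp only [Pi.sub_apply] at hz
    have h3 : (z : ℝ) < 1 := by linarith [h1.1, h2.2]
    have h4 : (-1 : ℝ) < z := by linarith [h1.2, h2.1]
    have h5 : z = 0 := by
      have h3' : z < 1 := by exact_mod_cast h3
      have h4' : -1 < z := by exact_mod_cast h4
      omega
    rw [h5] at hz
    simp at hz
    linarith
  have hvol : ∀ a, volume (Q a) = 1 := fun a => by simp [Q, Real.volume_pi_Ico]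
  have hsub : (⋃ a ∈ s, Q a) ⊆ K + frontCube n n := by
    refine Set.iUnion₂_subset fun a ha x hx => ⟨p a, hp a ha, x - p a, ⟨fun j => ?_, fun j => ?_⟩, by simp⟩
    · have := (hx j (Set.mem_univ _)).1
      simpa using this
    · have := (hx j (Set.mem_univ _)).2.le
      simp only [Pi.sub_apply, j.2, if_true]
      linarith
  have h := measure_mono (μ := volume) hsub
  rw [measure_biUnion_finset hdisj hQm] at h
  simp only [hvol, Finset.sum_const, nsmul_eq_mul, mul_one] at h
  have hfin : volume (K + frontCube n n) ≠ ⊤ :=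
    (hK.add (isCompact_frontCube n n)).measure_ne_top
  simpa [Measure.real] using ENNReal.toReal_mono hfin h

theorem card_quotient_range_toLin' {n : ℕ} (W : Matrix (Fin n) (Fin n) ℤ) (hW : W.det ≠ 0) :
    Nat.card ((Fin n → ℤ) ⧸ LinearMap.range (Matrix.toLin' W)) = W.det.natAbs := by
  have hinj : Function.Injective (Matrix.toLin' W) := by
    rw [Matrix.toLin'_apply']
    exact Matrix.mulVec_injective_of_det_ne_zero hW
  have := Submodule.natAbs_det_equiv (LinearMap.range (Matrix.toLin' W))
    (LinearEquiv.ofInjective _ hinj)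
  rw [← this]
  have h2 : ((LinearMap.range (Matrix.toLin' W)).subtype ∘ₗ AddMonoidHom.toIntLinearMap
      ((LinearEquiv.ofInjective _ hinj : (Fin n → ℤ) ≃ₗ[ℤ] _) : (Fin n → ℤ) →+ _)) =
      Matrix.toLin' W := by
    ext; rfl
  rw [h2, LinearMap.det_toLin']

/-- A convex body containing the vectors `± W eᵢ` for a nonsingular integer matrix `W` has few
lattice points. -/
theorem card_le_cubeFactor_mul_volume_real {n : ℕ} {K : Set (Fin n → ℝ)} (hc : IsCompact K)
    (hK : Convex ℝ K) (W : Matrix (Fin n) (Fin n) ℤ) (hW : W.det ≠ 0)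
    (h₁ : ∀ i, (fun j => (W j i : ℝ)) ∈ K) (h₂ : ∀ i, -(fun j => (W j i : ℝ)) ∈ K)
    (s : Finset (Fin n → ℤ)) (hs : ∀ z ∈ s, (fun j => (z j : ℝ)) ∈ K) :
    (s.card : ℝ) ≤ cubeFactor n n * volume.real K := by
  classical
  set A : Matrix (Fin n) (Fin n) ℝ := W.map (Int.cast : ℤ → ℝ) with hA
  have hdet : A.det = (W.det : ℝ) := by
    rw [hA]; exact (Int.cast_det W).symm
  have hAu : IsUnit A.det := by
    rw [hdet]; exact isUnit_iff_ne_zero.2 (by exact_mod_cast hW)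
  set g := Matrix.toLin' A⁻¹ with hg
  have hgA : ∀ x, g (A.mulVec x) = x := fun x => by
    simp [hg, Matrix.mulVec_mulVec, Matrix.nonsing_inv_mul A hAu]
  have hAg : ∀ x, A.mulVec (g x) = x := fun x => by
    simp [hg, Matrix.mulVec_mulVec, Matrix.mul_nonsing_inv A hAu]
  have hcK' : IsCompact (g '' K) := hc.image g.continuous_of_finiteDimensional
  have hK' : Convex ℝ (g '' K) := hK.linear_image g
  have hcol : ∀ i, g (fun j => (W j i : ℝ)) = Pi.single i 1 := fun i => by
    rw [← hgA (Pi.single i 1), Matrix.mulVec_single_one]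
    rfl
  have hbound := volume_real_add_frontCube_le n le_rfl hcK' hK'
    (fun i => ⟨_, h₁ i, hcol i⟩) (fun i => ⟨_, h₂ i, by rw [map_neg, hcol]⟩)
  have hvol : volume.real (g '' K) = |(W.det : ℝ)|⁻¹ * volume.real K := by
    rw [Measure.real, Measure.addHaar_image_linearMap, ENNReal.toReal_mul, hg,
      LinearMap.det_toLin', Matrix.det_nonsing_inv, Ring.inverse_eq_inv', hdet,
      ENNReal.toReal_ofReal (abs_nonneg _), abs_inv]
    rfl
  set R := LinearMap.range (Matrix.toLin' W)
  have hcard : Nat.card ((Fin n → ℤ) ⧸ R) = W.det.natAbs := card_quotient_range_toLin' W hW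
  have hfinite : Finite ((Fin n → ℤ) ⧸ R) :=
    Nat.finite_of_card_ne_zero (by rw [hcard]; exact Int.natAbs_ne_zero.2 hW)
  have := Fintype.ofFinite ((Fin n → ℤ) ⧸ R)
  -- Two points of one class differ by `W u` with `u` integral, so their images under `g` differ by
  -- `u`.
  have hfib : ∀ q : (Fin n → ℤ) ⧸ R, ((s.filter fun z => R.mkQ z = q).card : ℝ) ≤
      cubeFactor n n * volume.real (g '' K) := by
    intro q
    refine le_trans (card_le_volume_real_add_frontCube _ (fun z => g (fun j => (z j : ℝ))) hcK'
      (fun z hz => ⟨_, hs z (Finset.mem_filter.1 hz).1, rfl⟩) ?_ ?_) hbound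
    · intro z _ w _ hzw
      have := congrArg A.mulVec hzw
      simp only [hAg] at this
      funext j
      exact_mod_cast congrFun this j
    · intro z hz w hw
      have hz := (Finset.mem_filter.1 hz).2
      have hw := (Finset.mem_filter.1 hw).2
      have hmem : z - w ∈ R := by
        rw [← Submodule.ker_mkQ R, LinearMap.mem_ker, map_sub, hz, hw, sub_self]
      obtain ⟨u, hu⟩ := hmem
      have : (fun j => (z j : ℝ)) - (fun j => (w j : ℝ)) = A.mulVec (fun j => (u j : ℝ)) := by
        funext j
        have := congrFun hu j
        simp only [Matrix.toLin'_apply, Matrix.mulVec, dotProduct, Pi.sub_apply] at this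
        simp only [Pi.sub_apply, Matrix.mulVec, dotProduct, hA, Matrix.map_apply]
        exact_mod_cast this.symm
      rw [← map_sub, this, hgA]
      exact fun j => ⟨u j, rfl⟩
  calc (s.card : ℝ) = ∑ q : (Fin n → ℤ) ⧸ R, ((s.filter fun z => R.mkQ z = q).card : ℝ) := by
        rw [Finset.card_eq_sum_card_fiberwise (t := Finset.univ) (f := R.mkQ)
          (fun _ _ => Finset.mem_coe.2 (Finset.mem_univ _))]
        push_cast
        rfl
    _ ≤ ∑ q : (Fin n → ℤ) ⧸ R, cubeFactor n n * volume.real (g '' K) :=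
        Finset.sum_le_sum fun q _ => hfib q
    _ = cubeFactor n n * volume.real K := by
        rw [Finset.sum_const, Finset.card_univ, ← Nat.card_eq_fintype_card, hcard, nsmul_eq_mul,
          hvol, Nat.cast_natAbs, Int.cast_abs]
        have : |(W.det : ℝ)| ≠ 0 := abs_ne_zero.2 (by exact_mod_cast hW)
        field_simp

/-- Differences of points lie in the linear span, so full affine dimension forces the lattice points
to span; a basis chosen among them supplies the columns. -/
theorem exists_matrix_of_affDim_eq {n : ℕ} {A : Set (Fin n → ℝ)}
    (h : affDim (A ∩ intLattice n) = n) :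
    ∃ W : Matrix (Fin n) (Fin n) ℤ, W.det ≠ 0 ∧ ∀ i, (fun j => (W j i : ℝ)) ∈ A := by
  have hspan : Submodule.span ℝ (A ∩ intLattice n) = ⊤ := by
    refine top_unique ?_
    have h1 : vectorSpan ℝ (A ∩ intLattice n) = ⊤ := by
      rw [← direction_affineSpan]
      exact Submodule.eq_top_of_finrank_eq (by rw [Module.finrank_fin_fun]; exact h)
    rw [← h1, vectorSpan_def, Submodule.span_le]
    rintro _ ⟨x, hx, y, hy, rfl⟩
    exact Submodule.sub_mem _ (Submodule.subset_span hx) (Submodule.subset_span hy)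
  obtain ⟨b, hbA, hbspan, hli⟩ := exists_linearIndependent ℝ (A ∩ intLattice n)
  rw [hspan] at hbspan
  let B : Module.Basis b ℝ (Fin n → ℝ) := Module.Basis.mk hli (by simp [hbspan])
  have := Module.Finite.finite_basis B
  have := Fintype.ofFinite b
  have hcard : Fintype.card b = n := by
    rw [← Module.finrank_eq_card_basis B, Module.finrank_fin_fun]
  let B' := B.reindex (Fintype.equivFinOfCardEq hcard)
  have hB' : ∀ i, B' i ∈ A ∩ intLattice n := fun i => by
    have : B' i = ((Fintype.equivFinOfCardEq hcard).symm i : Fin n → ℝ) := by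
      simp [B', B, Module.Basis.reindex_apply]
    rw [this]
    exact hbA (Subtype.prop _)
  choose w hw using fun i => (hB' i).2
  refine ⟨Matrix.of fun j i => w i j, ?_, fun i => ?_⟩
  · have h1 : ((Matrix.of fun j i => w i j).map (Int.cast : ℤ → ℝ)) =
        (Pi.basisFun ℝ (Fin n)).toMatrix B' := by
      ext j i
      simp [Module.Basis.toMatrix_apply, hw]
    have h2 : ((Pi.basisFun ℝ (Fin n)).toMatrix B').det ≠ 0 := by
      rw [← Module.Basis.det_apply]
      exact (Module.Basis.isUnit_det _ B').ne_zero
    intro h0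
    apply h2
    rw [← h1, ← Int.cast_det, h0, Int.cast_zero]
  · convert (hB' i).1 using 1
    funext j
    simp [hw]

/-- The lattice point enumerator is the number of integer vectors whose image lies in the set. -/
theorem latticeCount_eq_ncard {n : ℕ} (S : Set (Fin n → ℝ)) :
    latticeCount S = {z : Fin n → ℤ | (fun j => (z j : ℝ)) ∈ S}.ncard := by
  have hinj : Function.Injective fun (z : Fin n → ℤ) (j : Fin n) => (z j : ℝ) := by
    intro z w h
    funext j
    simpa using congrFun h j
  rw [latticeCount, ← Set.ncard_image_of_injective _ hinj]
  congr 1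
  ext x
  constructor
  · rintro ⟨hx, hi⟩
    choose z hz using hi
    obtain rfl : x = fun j => (z j : ℝ) := funext hz
    exact ⟨z, hx, rfl⟩
  · rintro ⟨z, hz, rfl⟩
    exact ⟨hz, fun i => ⟨z i, rfl⟩⟩

theorem latticeCount_le_volume_real_mul {n : ℕ} {K : Set (Fin n → ℝ)} (hK : IsSymmBody K)
    (hdim : affDim (K ∩ intLattice n) = n) :
    (latticeCount K : ℝ) ≤ volume.real K * ((n.factorial : ℝ) * laguerre n 2 / 2 ^ n) := by
  obtain ⟨W, hW, hWK⟩ := exists_matrix_of_affDim_eq hdim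
  rw [latticeCount_eq_ncard, ← cubeFactor_self, mul_comm]
  rcases Set.finite_or_infinite {z : Fin n → ℤ | (fun j => (z j : ℝ)) ∈ K} with hf | hinf
  · rw [Set.ncard_eq_toFinset_card _ hf]
    exact card_le_cubeFactor_mul_volume_real hK.isCompact hK.convex W hW hWK
      (fun i => (hK.symm _).1 (hWK i)) _ fun z hz => by simpa using hz
  -- `Set.ncard` of an infinite set is 0, so this case needs only a nonnegative right-hand side.
  · rw [hinf.ncard]
    have : 0 ≤ cubeFactor n n := Finset.sum_nonneg fun k _ => by positivity
    simpa using mul_nonneg this measureReal_nonneg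

/-! ### Subexponential growth of `L_n(2)`. -/

/-- One term of the binomial expansion of `(1 + δ) ^ n` bounds each coefficient by `(1 + δ) ^ n / δ
^ k`; what remains is a partial sum of the series of `exp (2 / δ)`. -/
theorem laguerre_two_le (n : ℕ) {δ : ℝ} (hδ : 0 < δ) :
    laguerre n 2 ≤ (1 + δ) ^ n * Real.exp (2 / δ) := by
  calc laguerre n 2 ≤ ∑ k ∈ Finset.range (n + 1), (1 + δ) ^ n * ((2 / δ) ^ k / k.factorial) := by
        refine Finset.sum_le_sum fun k hk => ?_
        have h : (n.choose k : ℝ) * δ ^ k ≤ (1 + δ) ^ n := by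
          rw [add_comm, add_pow]
          have := Finset.single_le_sum (f := fun k => δ ^ k * 1 ^ (n - k) * (n.choose k : ℝ))
            (fun _ _ => by positivity) hk
          simpa [mul_comm] using this
        calc (n.choose k : ℝ) * 2 ^ k / k.factorial
            = (n.choose k : ℝ) * δ ^ k * ((2 / δ) ^ k / k.factorial) := by
              rw [div_pow]; field_simp
          _ ≤ _ := mul_le_mul_of_nonneg_right h (by positivity)
    _ = (1 + δ) ^ n * ∑ k ∈ Finset.range (n + 1), (2 / δ) ^ k / k.factorial := by
        rw [Finset.mul_sum]
    _ ≤ _ := mul_le_mul_of_nonneg_left (Real.sum_le_exp_of_nonneg (by positivity) _)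
        (by positivity)

theorem exists_pow_mul_laguerre_two_le {ε : ℝ} (h₀ : 0 < ε) (h₁ : ε ≤ 1) :
    ∃ N : ℕ, ∀ n : ℕ, N ≤ n → (2 - ε) ^ n * laguerre n 2 ≤ 2 ^ n := by
  -- With this choice `r = 1 - ε / 4 - ε ^ 2 / 8 < 1`, and `r ^ n` absorbs the constant `exp (2 /
  -- δ)`.
  set δ := ε / 4 with hδ
  have hδ₀ : 0 < δ := by positivity
  set r := (2 - ε) * (1 + δ) / 2 with hr
  have hr₀ : 0 ≤ r := by
    have : 0 ≤ 2 - ε := by linarith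
    positivity
  have hr₁ : r < 1 := by rw [hr, hδ]; nlinarith
  have hlim : Tendsto (fun n : ℕ => r ^ n * Real.exp (2 / δ)) atTop (𝓝 0) := by
    simpa using (tendsto_pow_atTop_nhds_zero_of_lt_one hr₀ hr₁).mul_const (Real.exp (2 / δ))
  obtain ⟨N, hN⟩ := eventually_atTop.1 (hlim.eventually_le_const zero_lt_one)
  refine ⟨N, fun n hn => ?_⟩
  calc (2 - ε) ^ n * laguerre n 2 ≤ (2 - ε) ^ n * ((1 + δ) ^ n * Real.exp (2 / δ)) :=
        mul_le_mul_of_nonneg_left (laguerre_two_le n hδ₀) (pow_nonneg (by linarith) n)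
    _ = 2 ^ n * (r ^ n * Real.exp (2 / δ)) := by
        rw [hr, div_pow, mul_pow]; field_simp
    _ ≤ 2 ^ n * 1 := mul_le_mul_of_nonneg_left (hN n hn) (by positivity)
    _ = 2 ^ n := mul_one _

/-! ### Crosspolytopes: inequality description, volume, lattice points. -/

/-- The semi-axes of `crosspolytope n l`. -/
noncomputable def semiAxis (n l : ℕ) (i : Fin n) : ℝ := if (i : ℕ) = 0 then (l : ℝ) else 1

theorem semiAxis_pos {n l : ℕ} (hl : 1 ≤ l) (i : Fin n) : 0 < semiAxis n l i := by
  unfold semiAxis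
  split_ifs
  · exact_mod_cast hl
  · exact one_pos

theorem convex_setOf_sum_abs_div_le {n : ℕ} {w : Fin n → ℝ} (hw : ∀ i, 0 < w i) :
    Convex ℝ {x : Fin n → ℝ | ∑ i, |x i| / w i ≤ 1} := by
  intro x hx y hy a b ha hb hab
  calc ∑ i, |(a • x + b • y) i| / w i ≤ ∑ i, (a * (|x i| / w i) + b * (|y i| / w i)) := by
        refine Finset.sum_le_sum fun i _ => ?_
        rw [← mul_div_assoc, ← mul_div_assoc, ← add_div]
        refine div_le_div_of_nonneg_right ?_ (hw i).le
        calc |a * x i + b * y i| ≤ |a * x i| + |b * y i| := abs_add_le _ _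
          _ = _ := by rw [abs_mul, abs_mul, abs_of_nonneg ha, abs_of_nonneg hb]
    _ = a * ∑ i, |x i| / w i + b * ∑ i, |y i| / w i := by
        rw [Finset.sum_add_distrib, Finset.mul_sum, Finset.mul_sum]
    _ ≤ a * 1 + b * 1 :=
        add_le_add (mul_le_mul_of_nonneg_left hx ha) (mul_le_mul_of_nonneg_left hy hb)
    _ = 1 := by rw [mul_one, mul_one, hab]

theorem crosspolytope_eq {n l : ℕ} (hn : 1 ≤ n) (hl : 1 ≤ l) :
    crosspolytope n l = {x | ∑ i, |x i| / semiAxis n l i ≤ 1} := by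
  have hw := semiAxis_pos (n := n) hl
  apply Set.Subset.antisymm
  · refine convexHull_min ?_ (convex_setOf_sum_abs_div_le hw)
    rintro v ⟨i, hv⟩
    change v = Pi.single i (semiAxis n l i) ∨ v = -Pi.single i (semiAxis n l i) at hv
    have : ∀ j, |v j| / semiAxis n l j = if j = i then 1 else 0 := by
      intro j
      by_cases hj : j = i
      · subst hj
        rcases hv with rfl | rfl <;> simp [abs_of_pos (hw j), (hw j).ne']
      · rcases hv with rfl | rfl <;> simp [hj]
    simp [this]
  · intro x hx
    have hmem : ∀ i, Pi.single i (semiAxis n l i) ∈ crosspolytope n l ∧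
        -Pi.single i (semiAxis n l i) ∈ crosspolytope n l := fun i =>
      ⟨subset_convexHull _ _ ⟨i, Or.inl rfl⟩, subset_convexHull _ _ ⟨i, Or.inr rfl⟩⟩
    have hconv : Convex ℝ (crosspolytope n l) := convex_convexHull _ _
    have h0 : (0 : Fin n → ℝ) ∈ crosspolytope n l := by
      have h := hmem ⟨0, hn⟩
      have := hconv h.1 h.2 (by norm_num : (0 : ℝ) ≤ 1 / 2) (by norm_num : (0 : ℝ) ≤ 1 / 2)
        (by norm_num)
      simpa using this
    -- A point is a convex combination of the vertices carrying the signs of its coordinates, with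
    -- weights `|x i| / semiAxis n l i`; the index `none` puts the leftover weight on the origin.
    have hsum := hconv.sum_mem (t := (Finset.univ : Finset (Option (Fin n))))
      (w := fun o => o.elim (1 - ∑ i, |x i| / semiAxis n l i) fun i => |x i| / semiAxis n l i)
      (z := fun o => o.elim 0 fun i =>
        if 0 ≤ x i then Pi.single i (semiAxis n l i) else -Pi.single i (semiAxis n l i))
      (by
        rintro (_ | i) _
        · exact sub_nonneg.2 hx
        · exact div_nonneg (abs_nonneg _) (hw i).le)
      (by simp [Fintype.sum_option])
      (by
        rintro (_ | i) _
        · exact h0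
        · simp only [Option.elim_some]
          split_ifs
          exacts [(hmem i).1, (hmem i).2])
    convert hsum using 1
    rw [Fintype.sum_option]
    funext j
    simp only [Option.elim_none, smul_zero, zero_add, Option.elim_some, Finset.sum_apply,
      Pi.smul_apply, smul_eq_mul]
    rw [Finset.sum_eq_single j]
    · have := (hw j).ne'
      split_ifs with h
      · simp [abs_of_nonneg h, this]
      · simp [abs_of_neg (not_le.1 h), this]
    · intro i _ hij
      split_ifs <;> simp [hij.symm]
    · simp

theorem isSymmBody_crosspolytope {n l : ℕ} (hn : 1 ≤ n) (hl : 1 ≤ l) :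
    IsSymmBody (crosspolytope n l) where
  convex := convex_convexHull _ _
  isCompact := by
    refine Set.Finite.isCompact_convexHull ℝ (Set.Finite.subset
      ((Set.finite_range fun i : Fin n => (Pi.single i (semiAxis n l i) : Fin n → ℝ)).union
        (Set.finite_range fun i : Fin n => (-Pi.single i (semiAxis n l i) : Fin n → ℝ))) ?_)
    rintro v ⟨i, rfl | rfl⟩
    · exact Or.inl ⟨i, rfl⟩
    · exact Or.inr ⟨i, rfl⟩
  nonempty_interior := by
    refine ⟨0, mem_interior.2 ⟨{x | ∑ i, |x i| / semiAxis n l i < 1}, ?_, ?_, by simp⟩⟩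
    · rw [crosspolytope_eq hn hl]
      exact fun x (hx : ∑ i, |x i| / semiAxis n l i < 1) => le_of_lt hx
    · exact isOpen_lt (by fun_prop) continuous_const
  symm x := by
    rw [crosspolytope_eq hn hl]
    simp

theorem affDim_crosspolytope {n l : ℕ} (hn : 1 ≤ n) (hl : 1 ≤ l) :
    affDim (crosspolytope n l ∩ intLattice n) = n := by
  have hw := semiAxis_pos (n := n) hl
  have h0 : (0 : Fin n → ℝ) ∈ crosspolytope n l ∩ intLattice n := by
    refine ⟨?_, fun i => ⟨0, by simp⟩⟩
    rw [crosspolytope_eq hn hl]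
    simp
  have h1 : ∀ i, (Pi.single i (semiAxis n l i) : Fin n → ℝ) ∈
      crosspolytope n l ∩ intLattice n := by
    refine fun i => ⟨subset_convexHull _ _ ⟨i, Or.inl rfl⟩, fun j => ?_⟩
    by_cases hj : j = i
    · subst hj
      refine ⟨if (j : ℕ) = 0 then l else 1, ?_⟩
      simp only [Pi.single_eq_same, semiAxis]
      split_ifs <;> simp
    · exact ⟨0, by simp [hj]⟩
  have htop : (affineSpan ℝ (crosspolytope n l ∩ intLattice n)).direction = ⊤ := by
    rw [direction_affineSpan, eq_top_iff, ← (Pi.basisFun ℝ (Fin n)).span_eq, Submodule.span_le]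
    rintro _ ⟨i, rfl⟩
    have h2 := Submodule.smul_mem _ (semiAxis n l i)⁻¹ (vsub_mem_vectorSpan ℝ (h1 i) h0)
    rw [vsub_eq_sub, sub_zero, ← Pi.single_smul, smul_eq_mul, inv_mul_cancel₀ (hw i).ne'] at h2
    simpa using h2
  rw [affDim, htop, finrank_top, Module.finrank_fin_fun]

/-- A diagonal map of determinant `l` carries the unit `ℓ¹` ball, of volume `2 ^ n / n!`, onto the
crosspolytope. -/
theorem factorial_mul_volume_real_crosspolytope {n l : ℕ} (hn : 1 ≤ n) (hl : 1 ≤ l) :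
    (n.factorial : ℝ) * volume.real (crosspolytope n l) = 2 ^ n * l := by
  have hw := semiAxis_pos (n := n) hl
  have : Nonempty (Fin n) := ⟨⟨0, hn⟩⟩
  have himg : crosspolytope n l =
      Matrix.toLin' (Matrix.diagonal (semiAxis n l)) '' {x : Fin n → ℝ | ∑ i, |x i| ≤ 1} := by
    rw [crosspolytope_eq hn hl]
    ext x
    constructor
    · intro hx
      refine ⟨fun i => x i / semiAxis n l i, ?_, ?_⟩
      · have : ∀ i, |x i / semiAxis n l i| = |x i| / semiAxis n l i := fun i => by
          rw [abs_div, abs_of_pos (hw i)]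
        simpa [this] using hx
      · funext i
        simp [Matrix.mulVec_diagonal, mul_div_cancel₀ _ (hw i).ne']
    · rintro ⟨y, hy, rfl⟩
      have : ∀ i, |semiAxis n l i * y i| / semiAxis n l i = |y i| := fun i => by
        rw [abs_mul, abs_of_pos (hw i), mul_div_cancel_left₀ _ (hw i).ne']
      simpa only [Matrix.toLin'_apply, Matrix.mulVec_diagonal, Set.mem_ofPred_eq, this] using hy
  have hprod : ∏ i, semiAxis n l i = l := by
    obtain ⟨m, rfl⟩ : ∃ m, n = m + 1 := ⟨n - 1, by omega⟩
    rw [Fin.prod_univ_succ]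
    simp [semiAxis]
  have hball : volume {x : Fin n → ℝ | ∑ i, |x i| ≤ 1} =
      ENNReal.ofReal (2 ^ n / n.factorial) := by
    have := volume_sum_rpow_le (Fin n) le_rfl 1
    simpa [Real.Gamma_nat_eq_factorial, one_add_one_eq_two] using this
  rw [himg, Measure.real, Measure.addHaar_image_linearMap, LinearMap.det_toLin',
    Matrix.det_diagonal, hprod, hball, ENNReal.toReal_mul, ENNReal.toReal_ofReal (abs_nonneg _),
    ENNReal.toReal_ofReal (by positivity), Nat.abs_cast]
  have := Nat.factorial_pos n
  field_simp

/-- All lattice points lie on the coordinate axes: a nonzero integer coordinate along a short axis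
already uses up the whole sum. Hence at most `n * (2 * l + 1)` points, while the long axis alone
supplies `l`. -/
theorem latticeCount_crosspolytope_bounds {n l : ℕ} (hn : 1 ≤ n) (hl : 1 ≤ l) :
    l ≤ latticeCount (crosspolytope n l) ∧ latticeCount (crosspolytope n l) ≤ 3 * n * l := by
  have hw := semiAxis_pos (n := n) hl
  have hl' : (0 : ℝ) < l := by exact_mod_cast hl
  rw [latticeCount_eq_ncard, crosspolytope_eq hn hl]
  set S : Set (Fin n → ℤ) := {z | (fun j => (z j : ℝ)) ∈ {x | ∑ i, |x i| / semiAxis n l i ≤ 1}}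
  have hmemS : ∀ z, z ∈ S ↔ ∑ i, |(z i : ℝ)| / semiAxis n l i ≤ 1 := fun z => Iff.rfl
  set T : Finset (Fin n → ℤ) :=
    (Finset.univ ×ˢ Finset.Icc (-(l : ℤ)) l).image fun q : Fin n × ℤ => Pi.single q.1 q.2
  have hST : S ⊆ T := by
    intro z hz
    rw [hmemS] at hz
    have hsingle : ∀ k, |z k| ≤ l → (∀ j, j ≠ k → z j = 0) → z ∈ (T : Set (Fin n → ℤ)) := by
      intro k hk hj
      refine Finset.mem_coe.2 (Finset.mem_image.2 ⟨(k, z k), ?_, ?_⟩)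
      · simpa using abs_le.1 hk
      · funext j
        by_cases h : j = k
        · subst h; simp
        · simp [h, hj j h]
    have hnn : ∀ i, 0 ≤ |(z i : ℝ)| / semiAxis n l i := fun i =>
      div_nonneg (abs_nonneg _) (hw i).le
    have hle : ∀ i, |(z i : ℝ)| / semiAxis n l i ≤ 1 := fun i =>
      (Finset.single_le_sum (fun i _ => hnn i) (Finset.mem_univ i)).trans hz
    by_cases hex : ∃ k : Fin n, (k : ℕ) ≠ 0 ∧ z k ≠ 0
    · obtain ⟨k, hk, hzk⟩ := hex
      have hwk : semiAxis n l k = 1 := by simp [semiAxis, hk]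
      have h1 := hle k
      rw [hwk, div_one] at h1
      have h2 : |z k| ≤ 1 := by exact_mod_cast h1
      have h3 : (1 : ℝ) ≤ |(z k : ℝ)| := by exact_mod_cast Int.one_le_abs hzk
      refine hsingle k (h2.trans (by exact_mod_cast hl)) fun j hj => ?_
      have h4 := Finset.add_le_sum (fun i _ => hnn i) (Finset.mem_univ j) (Finset.mem_univ k) hj
      rw [hwk, div_one] at h4
      have h5 : |(z j : ℝ)| / semiAxis n l j = 0 := le_antisymm (by linarith) (hnn j)
      simpa [(hw j).ne'] using h5
    · push Not at hex
      refine hsingle ⟨0, hn⟩ ?_ fun j hj => hex j fun h => hj (Fin.ext h)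
      have h1 := hle ⟨0, hn⟩
      simp only [semiAxis, if_true] at h1
      rw [div_le_one hl'] at h1
      exact_mod_cast h1
  constructor
  · have hsub : (fun a : ℕ => (Pi.single ⟨0, hn⟩ (a : ℤ) : Fin n → ℤ)) '' (Finset.range l) ⊆ S := by
      rintro _ ⟨a, ha, rfl⟩
      rw [hmemS, Finset.sum_eq_single ⟨0, hn⟩]
      · simp only [semiAxis, if_true, Pi.single_eq_same, Int.cast_natCast, Nat.abs_cast]
        rw [div_le_one hl']
        exact_mod_cast (Finset.mem_range.1 (Finset.mem_coe.1 ha)).le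
      · intro i _ hi
        simp [hi]
      · simp
    have hinj : Function.Injective fun a : ℕ => (Pi.single ⟨0, hn⟩ (a : ℤ) : Fin n → ℤ) := by
      intro a b hab
      exact_mod_cast Pi.single_injective _ hab
    calc l = ((fun a : ℕ => (Pi.single ⟨0, hn⟩ (a : ℤ) : Fin n → ℤ)) '' (Finset.range l)).ncard := by
          rw [Set.ncard_image_of_injective _ hinj, Set.ncard_coe_finset, Finset.card_range]
      _ ≤ S.ncard := Set.ncard_le_ncard hsub (T.finite_toSet.subset hST)
  · calc S.ncard ≤ (T : Set (Fin n → ℤ)).ncard := Set.ncard_le_ncard hST T.finite_toSet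
      _ = T.card := Set.ncard_coe_finset T
      _ ≤ n * (2 * l + 1) := by
          refine Finset.card_image_le.trans (le_of_eq ?_)
          rw [Finset.card_product, Finset.card_univ, Fintype.card_fin, Int.card_Icc]
          congr 1
          omega
      _ ≤ 3 * n * l := by nlinarith

/-- The root equals `2 * (l / #) ^ (1 / n)`, where `#` is the lattice point count. It is squeezed
between `2 * (3 * n) ^ (-1 / n)` and 2, uniformly in `l`. -/
theorem tendsto_crosspolytope_ratio :
    Tendsto (fun p : ℕ × ℕ =>
        ((p.1.factorial : ℝ) * volume.real (crosspolytope p.1 p.2) /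
          (latticeCount (crosspolytope p.1 p.2) : ℝ)) ^ ((1 : ℝ) / (p.1 : ℝ)))
      (atTop ×ˢ atTop) (𝓝 2) := by
  have hlow : Tendsto (fun n : ℕ => 2 * ((3 * n : ℝ) ^ ((1 : ℝ) / n))⁻¹) atTop (𝓝 2) := by
    have h3 : Tendsto (fun n : ℕ => (3 * n : ℝ)) atTop atTop :=
      tendsto_natCast_atTop_atTop.const_mul_atTop (by norm_num)
    -- At `x = 3 * n` the exponent `3 / x` is `1 / n`.
    have h := (tendsto_rpow_div_mul_add 3 1 0 zero_ne_one).comp h3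
    have h' : Tendsto (fun n : ℕ => (3 * n : ℝ) ^ ((1 : ℝ) / n)) atTop (𝓝 1) := by
      refine h.congr fun n => ?_
      simp only [Function.comp_apply, one_mul, add_zero]
      congr 1
      rw [mul_comm, div_mul_eq_div_div_swap, div_self three_ne_zero]
    simpa using (h'.inv₀ one_ne_zero).const_mul 2
  have hev : ∀ᶠ p : ℕ × ℕ in atTop ×ˢ atTop, 1 ≤ p.1 ∧ 1 ≤ p.2 :=
    (eventually_ge_atTop 1).prod_mk (eventually_ge_atTop 1)
  have hform : ∀ p : ℕ × ℕ, 1 ≤ p.1 → 1 ≤ p.2 →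
      ((p.1.factorial : ℝ) * volume.real (crosspolytope p.1 p.2) /
          (latticeCount (crosspolytope p.1 p.2) : ℝ)) ^ ((1 : ℝ) / (p.1 : ℝ)) =
        2 * ((p.2 : ℝ) / latticeCount (crosspolytope p.1 p.2)) ^ ((1 : ℝ) / (p.1 : ℝ)) := by
    intro p h₁ h₂
    rw [factorial_mul_volume_real_crosspolytope h₁ h₂, mul_div_assoc,
      Real.mul_rpow (by positivity) (by positivity), one_div,
      Real.pow_rpow_inv_natCast zero_le_two (by omega)]
  refine tendsto_of_tendsto_of_tendsto_of_le_of_le' (hlow.comp tendsto_fst)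
    (tendsto_const_nhds (x := (2 : ℝ))) ?_ ?_
  · filter_upwards [hev] with p hp
    obtain ⟨hlo, hup⟩ := latticeCount_crosspolytope_bounds hp.1 hp.2
    have h1 : (0 : ℝ) < p.1 := by exact_mod_cast hp.1
    have h2 : (0 : ℝ) < p.2 := by exact_mod_cast hp.2
    have hc : (0 : ℝ) < latticeCount (crosspolytope p.1 p.2) := by
      exact_mod_cast hp.2.trans hlo
    rw [hform p hp.1 hp.2, Function.comp_apply, ← Real.inv_rpow (by positivity)]
    refine mul_le_mul_of_nonneg_left (Real.rpow_le_rpow (by positivity) ?_ (by positivity))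
      zero_le_two
    rw [inv_eq_one_div, div_le_div_iff₀ (by positivity) hc]
    have : (latticeCount (crosspolytope p.1 p.2) : ℝ) ≤ 3 * p.1 * p.2 := by exact_mod_cast hup
    linarith
  · filter_upwards [hev] with p hp
    obtain ⟨hlo, hup⟩ := latticeCount_crosspolytope_bounds hp.1 hp.2
    rw [hform p hp.1 hp.2]
    have : ((p.2 : ℝ) / latticeCount (crosspolytope p.1 p.2)) ^ ((1 : ℝ) / (p.1 : ℝ)) ≤ 1 :=
      Real.rpow_le_one (by positivity) (div_le_one_of_le₀ (by exact_mod_cast hlo) (by positivity))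
        (by positivity)
    linarith

/-! ### The theorem. -/

theorem theorem1p2 :
    -- the asymptotic Blichfeldt-type inequality
    (∀ ε : ℝ, 0 < ε → ε ≤ 1 → ∃ N : ℕ, ∀ n : ℕ, N ≤ n → ∀ K : Set (Fin n → ℝ),
      IsSymmBody K → affDim (K ∩ intLattice n) = n →
        (2 - ε) ^ n / (n.factorial : ℝ) * (latticeCount K : ℝ) ≤ volume.real K) ∧
    -- the inequality valid in every dimension
    (∀ (n : ℕ) (K : Set (Fin n → ℝ)),
      IsSymmBody K → affDim (K ∩ intLattice n) = n →
        (latticeCount K : ℝ) ≤ volume.real K * ((n.factorial : ℝ) * laguerre n 2 / 2 ^ n)) ∧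
    -- the constant 2 cannot be replaced by a bigger one
    (∀ c : ℝ, 2 < c →
      ¬ ∀ ε : ℝ, 0 < ε → ε ≤ 1 → ∃ N : ℕ, ∀ n : ℕ, N ≤ n → ∀ K : Set (Fin n → ℝ),
        IsSymmBody K → affDim (K ∩ intLattice n) = n →
          (c - ε) ^ n / (n.factorial : ℝ) * (latticeCount K : ℝ) ≤ volume.real K) ∧
    -- this is shown by the crosspolytopes: they are admissible, and their ratio tends to 2
    (∀ n l : ℕ, 1 ≤ n → 1 ≤ l →
      IsSymmBody (crosspolytope n l) ∧ affDim (crosspolytope n l ∩ intLattice n) = n) ∧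
    Tendsto (fun p : ℕ × ℕ =>
        ((p.1.factorial : ℝ) * volume.real (crosspolytope p.1 p.2) /
          (latticeCount (crosspolytope p.1 p.2) : ℝ)) ^ ((1 : ℝ) / (p.1 : ℝ)))
      (atTop ×ˢ atTop) (𝓝 2) := by
  refine ⟨fun ε h₀ h₁ => ?_, fun n K hK hdim => latticeCount_le_volume_real_mul hK hdim,
    fun c hc H => ?_,
    fun n l hn hl => ⟨isSymmBody_crosspolytope hn hl, affDim_crosspolytope hn hl⟩,
    tendsto_crosspolytope_ratio⟩
  · obtain ⟨N, hN⟩ := exists_pow_mul_laguerre_two_le h₀ h₁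
    refine ⟨N, fun n hn K hK hdim => ?_⟩
    have hf : (0 : ℝ) < n.factorial := by exact_mod_cast n.factorial_pos
    calc (2 - ε) ^ n / (n.factorial : ℝ) * (latticeCount K : ℝ)
        ≤ (2 - ε) ^ n / (n.factorial : ℝ) *
          (volume.real K * ((n.factorial : ℝ) * laguerre n 2 / 2 ^ n)) :=
          mul_le_mul_of_nonneg_left (latticeCount_le_volume_real_mul hK hdim)
            (div_nonneg (pow_nonneg (by linarith) n) hf.le)
      _ = volume.real K * ((2 - ε) ^ n * laguerre n 2 / 2 ^ n) := by field_simp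
      _ ≤ volume.real K * 1 :=
          mul_le_mul_of_nonneg_left (div_le_one_of_le₀ (hN n hn) (by positivity))
            measureReal_nonneg
      _ = volume.real K := mul_one _
  -- This keeps `c - ε > 2`. The assumed inequality makes the crosspolytope root at least `c - ε`
  -- for all large `n`, contradicting the limit 2.
  · set ε := min 1 ((c - 2) / 2) with hε
    have hε₀ : 0 < ε := lt_min one_pos (by linarith)
    have hb : 2 < c - ε := by
      have : ε ≤ (c - 2) / 2 := min_le_right _ _
      linarith
    obtain ⟨N, hN⟩ := H ε hε₀ (min_le_left _ _)
    have hev : ∀ᶠ p : ℕ × ℕ in atTop ×ˢ atTop, max N 1 ≤ p.1 ∧ 1 ≤ p.2 :=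
      (eventually_ge_atTop _).prod_mk (eventually_ge_atTop 1)
    obtain ⟨⟨n, l⟩, hlt, hn, hl⟩ :=
      ((tendsto_crosspolytope_ratio.eventually_lt_const hb).and hev).exists
    simp only at hlt hn hl
    have hn₁ : 1 ≤ n := (le_max_right _ _).trans hn
    have hK := hN n ((le_max_left _ _).trans hn) _ (isSymmBody_crosspolytope hn₁ hl)
      (affDim_crosspolytope hn₁ hl)
    have hc₀ : (0 : ℝ) < latticeCount (crosspolytope n l) := by
      exact_mod_cast hl.trans (latticeCount_crosspolytope_bounds hn₁ hl).1
    have hf : (0 : ℝ) < n.factorial := by exact_mod_cast n.factorial_pos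
    have hpow : (c - ε) ^ n ≤ (n.factorial : ℝ) * volume.real (crosspolytope n l) /
        (latticeCount (crosspolytope n l) : ℝ) := by
      rw [le_div_iff₀ hc₀]
      rw [div_mul_eq_mul_div, div_le_iff₀ hf] at hK
      linarith
    have hb₀ : 0 ≤ c - ε := by linarith
    have hroot := Real.rpow_le_rpow (pow_nonneg hb₀ n) hpow
      (by positivity : (0 : ℝ) ≤ 1 / (n : ℝ))
    rw [one_div, Real.pow_rpow_inv_natCast hb₀ (by omega), ← one_div] at hroot
    exact absurd hlt (not_lt.2 hroot)
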